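/- Let $z\in\mathbb{C}$ with $\operatorname{Re} z>1$ and let $a>0$. Put $\Omega(\omega)=\frac{1-e^{-i\omega}}{i\omega}$ (with $\Omega(0)=1$) and $\Omega_a(\omega)=\frac{1-e^{-(a+i\omega)}}{a+i\omega}$ for $\omega\in\mathbb{R}$. Let $$B_z(x)=\frac1{2\pi}\int_{\mathbb{R}}\Omega(\omega)^z e^{i\omega x}\,d\omega,\qquad E_{z,a}(x)=\frac1{2\pi}\int_{\mathbb{R}}\Omega_a(\omega)^z e^{i\omega x}\,d\omega$$ (principal branch of the power) be the polynomial and the exponential B-spline of complex order $z$, that is, the continuous functions with Fourier transforms $\widehat{B_z}=\Omega^z$ and $\widehat{E_{z,a}}=\Omega_a^z$, where $\widehat f(\omega)=\int f(x)e^{-i\omega x}dx$. Let $C_{0,0}(\mathbb{R}_0^+,\mathbb{C})$ be the space of continuous $g:[0,\infty)\to\mathbb{C}$ with $g(0)=0$ and $\lim_{x\to\infty}g(x)=0$. Let $L_1(x)=\frac2\pi\arctan x$ and $L_2(x)=x+1$ for $x\in[0,\infty)$. These maps are bijections of $[0,\infty)$ onto $[0,1)$ and onto $[1,\infty)$, respectively,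 and the restrictions of $B_z$ and $E_{z,a}$ to $[0,\infty)$ belong to $C_{0,0}(\mathbb{R}_0^+,\mathbb{C})$. For $\boldsymbol\alpha=(\alpha_1,\alpha_2)\in(-1,1)^2$ and $f\in\{B_z,E_{z,a}\}$ let $$Tg=f+\alpha_n\, g\circ L_n^{-1}\quad\text{on } L_n([0,\infty)),\ n=1,2,$$ and write $T_1$ for $T$ with seed $f=B_z$ and $T_2$ for $T$ with seed $f=E_{z,a}$. Then $T_1$ and $T_2$ map $C_{0,0}(\mathbb{R}_0^+,\mathbb{C})$ into itself, and each has a unique fixed point there, denoted $\mathfrak{B}_z(\boldsymbol\alpha)$ and $\mathfrak{E}_{z,a}(\boldsymbol\alpha)$, respectively. These satisfy the self-referential equations $$\mathfrak{B}_z(x)=\begin{cases}B_z(x)+\alpha_1\,\mathfrak{B}_z\big(\tan\tfrac{\pi x}{2}\big),&0\le x<1,\\ B_z(x)+\alpha_2\,\mathfrak{B}_z(x-1),&x\ge1,\end{cases}\qquad \mathfrak{E}_{z,a}(x)=\begin{cases}E_{z,a}(x)+\alpha_1\,\mathfrak{E}_{z,a}\big(\tan\tfrac{\pi x}{2}\big),&0\le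 x<1,\\ E_{z,a}(x)+\alpha_2\,\mathfrak{E}_{z,a}(x-1),&x\ge1.\end{cases}$$ For $\boldsymbol\alpha=(0,0)$ they are the seeds $B_z$ and $E_{z,a}$ (restricted to $[0,\infty)$), and for fixed $z$ and $a$ each of the sets of functions $\{\mathfrak{B}_z(\boldsymbol\alpha):\boldsymbol\alpha\in(-1,1)^2\}$ and $\{\mathfrak{E}_{z,a}(\boldsymbol\alpha):\boldsymbol\alpha\in(-1,1)^2\}$ is uncountable. -/

import Mathlib

open Set Filter Topology
open scoped NNReal

noncomputable section

namespace FractalSpline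

/-- `Ω(ω) = (1 - e^{-iω}) / (iω)`, with the removable singularity at `ω = 0` filled in. -/
def Omega (ω : ℝ) : ℂ :=
  if ω = 0 then 1 else (1 - Complex.exp (-(Complex.I * ω))) / (Complex.I * ω)

/-- `Ω_a(ω) = (1 - e^{-(a + iω)}) / (a + iω)`. -/
def OmegaExp (a ω : ℝ) : ℂ :=
  (1 - Complex.exp (-(a + Complex.I * ω))) / (a + Complex.I * ω)

/-- The continuous function on the line with Fourier transform
`φ(ω) = ∫ f(x) e^{-iωx} dx`, i.e. the inverse Fourier integral of `φ`. -/
def inverseFourier (φ : ℝ → ℂ) (x : ℝ) : ℂ :=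
  (2 * Real.pi : ℂ)⁻¹ * ∫ ω : ℝ, Complex.exp (Complex.I * ω * x) * φ ω

/-- The polynomial B-spline `B_z` of complex order `z`: its Fourier transform is `Ω(ω)^z`
(principal branch; `Ω` never takes negative real values). -/
def polyBSpline (z : ℂ) : ℝ → ℂ :=
  inverseFourier fun ω => Omega ω ^ z

/-- The exponential B-spline `E_{z,a}` of complex order `z`: its Fourier transform is
`Ω_a(ω)^z` (principal branch). -/
def expBSpline (z : ℂ) (a : ℝ) : ℝ → ℂ :=
  inverseFourier fun ω => OmegaExp a ω ^ z

/-- The restriction to `[0, ∞)` of a function on the line. -/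
def restrictNonneg (f : ℝ → ℂ) : ℝ≥0 → ℂ := fun x => f x

/-- The space `C_{0,0}([0, ∞), ℂ)`: continuous, zero at `0` and tending to zero at `∞`. -/
def C00 : Set (ℝ≥0 → ℂ) :=
  {g | Continuous g ∧ g 0 = 0 ∧ Tendsto g atTop (𝓝 0)}

open Classical in
/-- The Read-Bajraktarević operator on `[0, ∞)` with seed `f`, base function zero, scaling
factors `α n` and injective maps `L n` whose ranges partition `[0, ∞)`:
`T g = f + α n • g ∘ (L n)⁻¹` on the range of `L n`. -/
def rbOperator {N : ℕ} (L : Fin N → ℝ≥0 → ℝ≥0) (α : Fin N → ℝ) (f g : ℝ≥0 → ℂ) : ℝ≥0 → ℂ :=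
  fun x => f x + ∑ n, if x ∈ range (L n) then (α n : ℂ) * g (Function.invFun (L n) x) else 0

/-- `L₁(x) = (2/π) arctan x`. -/
def L₁ (x : ℝ≥0) : ℝ≥0 :=
  ⟨2 / Real.pi * Real.arctan x,
    mul_nonneg (by positivity) (Real.arctan_nonneg.2 x.2)⟩

/-- `L₂(x) = x + 1`. -/
def L₂ (x : ℝ≥0) : ℝ≥0 := x + 1

/-- The operator `T₁`, with seed `B_z`. -/
def T₁ (z : ℂ) (α : Fin 2 → ℝ) : (ℝ≥0 → ℂ) → ℝ≥0 → ℂ :=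
  rbOperator ![L₁, L₂] α (restrictNonneg (polyBSpline z))

/-- The operator `T₂`, with seed `E_{z,a}`. -/
def T₂ (z : ℂ) (a : ℝ) (α : Fin 2 → ℝ) : (ℝ≥0 → ℂ) → ℝ≥0 → ℂ :=
  rbOperator ![L₁, L₂] α (restrictNonneg (expBSpline z a))

/-- The parameter set `(-1, 1)²`. -/
def params : Set (Fin 2 → ℝ) := {α | ∀ n, |α n| < 1}

/-- The self-referential equation on `[0, ∞)` with seed `f`:
`g = f + α₁ g(tan(πx/2))` on `[0, 1)` and `g = f + α₂ g(x - 1)` on `[1, ∞)`. -/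
def SelfReferential (α : Fin 2 → ℝ) (f g : ℝ≥0 → ℂ) : Prop :=
  (∀ x : ℝ≥0, x < 1 →
    g x = f x + (α 0 : ℂ) * g (Real.toNNReal (Real.tan (Real.pi * (x : ℝ) / 2)))) ∧
  (∀ x : ℝ≥0, 1 ≤ x → g x = f x + (α 1 : ℂ) * g (x - 1))

end FractalSpline

end

/-!
Both seeds are treated through the entire function `F s = (1 - e^{-s}) / s` (`expMean`): `Ω` is its
restriction to the imaginary axis and `Ω_a` its restriction to the line `Re s = a`.

On the closed right half-plane `F` avoids the negative real axis and `|F s| ≤ 4 / (1 + |s|)`, so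
for `Re z > 1` the power `F ^ z` is continuous there, holomorphic in the interior, and
`O(|s|^{-Re z})`. Integrability on vertical lines gives continuity of the seed, and the
Riemann-Lebesgue lemma gives its limit at infinity. For `x ≤ 0` the factor `e^{sx}` is bounded on
the right half-plane, and Cauchy's theorem on growing rectangles shows that the seed vanishes on
`(-∞, 0]` (`integral_exp_mul_expMean_cpow_eq_zero`). In particular it vanishes at `0`, and it
cannot vanish on all of `[0, ∞)`, since by Fourier inversion `F ^ z` would then be zero on the line.

For any seed in `C_{0,0}` the operator preserves `C_{0,0}`: the value `0` of `g` at infinity and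
at the origin makes the two pieces match at `1` (`rbOperator_mem_C00`). It is a contraction with
constant `max |α₁| |α₂|`, so Banach's theorem on a closed subspace of `C₀([0, ∞), ℂ)` yields the
unique fixed point, and the fixed point equation, read on the two ranges, is the self-referential
equation. When the seed is nonzero, the fixed point determines `α` (`eq_of_fixed_of_fixed`), so the
family is parametrized injectively by the uncountable set `(-1, 1)²`.
-/

namespace FractalSpline

open MeasureTheory

/-! ### The entire function `(1 - e^{-s}) / s` -/

/-- The entire function `s ↦ (1 - e^{-s}) / s = ∫₀¹ e^{-st} dt`, with its removable singularity at
`0` filled in. On the imaginary axis it is `Ω`, on the line `Re s = a` it is `Ω_a`. -/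
noncomputable def expMean (s : ℂ) : ℂ :=
  if s = 0 then 1 else (1 - Complex.exp (-s)) / s

theorem expMean_zero : expMean 0 = 1 := if_pos rfl

theorem expMean_of_ne_zero {s : ℂ} (hs : s ≠ 0) : expMean s = (1 - Complex.exp (-s)) / s :=
  if_neg hs

theorem Omega_eq_expMean (ω : ℝ) : Omega ω = expMean (ω * Complex.I) := by
  by_cases h : ω = 0
  · simp [Omega, expMean, h]
  · simp [Omega, expMean, h, mul_comm]

theorem OmegaExp_eq_expMean {a : ℝ} (ha : 0 < a) (ω : ℝ) :
    OmegaExp a ω = expMean (a + ω * Complex.I) := by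
  have h : (a + ω * Complex.I : ℂ) ≠ 0 := fun h => by
    have := congrArg Complex.re h
    simp at this
    exact ha.ne' this
  rw [expMean_of_ne_zero h, OmegaExp, mul_comm Complex.I]

theorem continuous_expMean : Continuous expMean := by
  have hd : Differentiable ℂ fun s : ℂ => 1 - Complex.exp (-s) := by fun_prop
  have heq : expMean = dslope (fun s : ℂ => 1 - Complex.exp (-s)) 0 := by
    funext s
    by_cases hs : s = 0
    · have h1 : HasDerivAt (fun s : ℂ => 1 - Complex.exp (-s)) 1 0 := by
        simpa using ((hasDerivAt_neg (0 : ℂ)).cexp).const_sub 1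
      rw [hs, expMean_zero, dslope_same, h1.deriv]
    · rw [expMean_of_ne_zero hs, dslope_of_ne _ hs, slope_def_field]
      simp
  rw [heq, continuous_iff_continuousAt]
  intro s
  by_cases hs : s = 0
  · rw [hs]
    exact continuousAt_dslope_same.2 (hd 0)
  · exact (continuousAt_dslope_of_ne hs).2 (hd s).continuousAt

theorem differentiableAt_expMean {s : ℂ} (hs : s ≠ 0) : DifferentiableAt ℂ expMean s := by
  have h : DifferentiableAt ℂ (fun s : ℂ => (1 - Complex.exp (-s)) / s) s := by
    fun_prop (disch := exact hs)
  refine h.congr_of_eventuallyEq ?_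
  filter_upwards [isOpen_ne.mem_nhds hs] with w hw using expMean_of_ne_zero hw

theorem norm_expMean_le {s : ℂ} (hs : 0 ≤ s.re) : ‖expMean s‖ ≤ 4 / (1 + ‖s‖) := by
  have hpos : 0 < 1 + ‖s‖ := by positivity
  by_cases h0 : s = 0
  · rw [h0, expMean_zero]
    norm_num
  have hn : 0 < ‖s‖ := norm_pos_iff.2 h0
  rw [expMean_of_ne_zero h0, norm_div, div_le_div_iff₀ hn hpos]
  rcases le_total ‖s‖ 1 with h1 | h1
  · have h2 : ‖1 - Complex.exp (-s)‖ ≤ 2 * ‖s‖ := by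
      rw [norm_sub_rev]
      simpa using Complex.norm_exp_sub_one_le (x := -s) (by simpa using h1)
    nlinarith [norm_nonneg (1 - Complex.exp (-s))]
  · have h2 : ‖1 - Complex.exp (-s)‖ ≤ 2 := by
      refine (norm_sub_le _ _).trans ?_
      rw [norm_one, Complex.norm_exp]
      have : Real.exp (-s).re ≤ 1 := Real.exp_le_one_iff.2 (by simpa using hs)
      linarith
    nlinarith [norm_nonneg (1 - Complex.exp (-s))]

theorem expMean_im {s : ℂ} (hs : s ≠ 0) :
    (expMean s).im = (Real.exp (-s.re) * (s.re * Real.sin s.im + s.im * Real.cos s.im) - s.im) /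
      Complex.normSq s := by
  rw [expMean_of_ne_zero hs, Complex.div_im]
  simp [Complex.exp_re, Complex.exp_im]
  ring

theorem expMean_re {s : ℂ} (hs : s ≠ 0) :
    (expMean s).re = ((1 - Real.exp (-s.re) * Real.cos s.im) * s.re +
      Real.exp (-s.re) * Real.sin s.im * s.im) / Complex.normSq s := by
  rw [expMean_of_ne_zero hs, Complex.div_re]
  simp [Complex.exp_re, Complex.exp_im]
  ring

/-- Off the real axis in the open right half-plane `(1 - e^{-s}) / s` is not real, because
`|σ sin τ + τ cos τ| ≤ |τ| (1 + σ) < |τ| e^σ` for `s = σ + iτ`. -/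
theorem expMean_im_ne_zero {s : ℂ} (hs : 0 < s.re) (hi : s.im ≠ 0) : (expMean s).im ≠ 0 := by
  have h0 : s ≠ 0 := fun h => hi (by simp [h])
  rw [expMean_im h0]
  refine div_ne_zero ?_ (Complex.normSq_pos.2 h0).ne'
  intro h
  have hτ : 0 < |s.im| := abs_pos.2 hi
  have h1 : s.re * Real.sin s.im + s.im * Real.cos s.im = s.im * Real.exp s.re := by
    have : Real.exp s.re * Real.exp (-s.re) = 1 := by rw [← Real.exp_add]; simp
    linear_combination Real.exp s.re * h -
      (s.re * Real.sin s.im + s.im * Real.cos s.im) * this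
  have h2 : |s.re * Real.sin s.im| ≤ s.re * |s.im| := by
    rw [abs_mul, abs_of_pos hs]
    exact mul_le_mul_of_nonneg_left Real.abs_sin_le_abs hs.le
  have h3 : |s.im * Real.cos s.im| ≤ |s.im| := by
    rw [abs_mul]
    exact mul_le_of_le_one_right hτ.le (Real.abs_cos_le_one _)
  have h4 : |s.im| * Real.exp s.re ≤ s.re * |s.im| + |s.im| := by
    rw [← abs_of_pos (Real.exp_pos s.re), ← abs_mul, ← h1]
    exact (abs_add_le _ _).trans (add_le_add h2 h3)
  nlinarith [Real.add_one_lt_exp hs.ne']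

theorem expMean_mem_slitPlane {s : ℂ} (hs : 0 < s.re) : expMean s ∈ Complex.slitPlane := by
  rw [Complex.mem_slitPlane_iff]
  by_cases hi : s.im = 0
  · left
    have h0 : s ≠ 0 := fun h => hs.ne' (by simp [h])
    rw [expMean_re h0, hi]
    refine div_pos ?_ (Complex.normSq_pos.2 h0)
    have : Real.exp (-s.re) < 1 := by rw [Real.exp_lt_one_iff]; linarith
    simpa using mul_pos (sub_pos.2 this) hs
  · exact Or.inr (expMean_im_ne_zero hs hi)

/-- On the closed right half-plane `(1 - e^{-s}) / s` avoids the negative real axis; it may vanish,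
at the nonzero multiples of `2πi`. -/
theorem expMean_re_nonneg_or_im_ne_zero {s : ℂ} (hs : 0 ≤ s.re) :
    0 ≤ (expMean s).re ∨ (expMean s).im ≠ 0 := by
  rcases hs.eq_or_lt with h | h
  · by_cases h0 : s = 0
    · simp [h0, expMean_zero]
    have hi : s.im ≠ 0 := fun hi => h0 (Complex.ext h.symm hi)
    by_cases hc : Real.cos s.im = 1
    · left
      have hsin : Real.sin s.im = 0 := by
        have := Real.sin_sq_add_cos_sq s.im
        rw [hc] at this
        nlinarith
      simp [expMean_re h0, ← h, hsin]
    · right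
      rw [expMean_im h0, ← h]
      refine div_ne_zero ?_ (Complex.normSq_pos.2 h0).ne'
      have : s.im * (Real.cos s.im - 1) ≠ 0 := mul_ne_zero hi (sub_ne_zero.2 hc)
      convert this using 1
      simp
      ring
  · exact (Complex.mem_slitPlane_iff.1 (expMean_mem_slitPlane h)).imp_left le_of_lt

/-! ### Complex powers of `(1 - e^{-s}) / s` on the right half-plane -/

theorem continuousAt_expMean_cpow {z s : ℂ} (hz : 0 < z.re) (hs : 0 ≤ s.re) :
    ContinuousAt (fun s => expMean s ^ z) s :=
  ContinuousAt.comp (f := expMean) (g := fun w : ℂ => w ^ z)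
    (Complex.continuousAt_cpow_const_of_re_pos (expMean_re_nonneg_or_im_ne_zero hs) hz)
    continuous_expMean.continuousAt

theorem differentiableAt_expMean_cpow (z : ℂ) {s : ℂ} (hs : 0 < s.re) :
    DifferentiableAt ℂ (fun s => expMean s ^ z) s :=
  (differentiableAt_expMean fun h => hs.ne' (by simp [h])).cpow (differentiableAt_const z)
    (expMean_mem_slitPlane hs)

theorem norm_expMean_cpow_le {z : ℂ} (hz : 0 < z.re) :
    ∃ C : ℝ, 0 ≤ C ∧ ∀ s : ℂ, 0 ≤ s.re → ‖expMean s ^ z‖ ≤ C * (1 + ‖s‖) ^ (-z.re) := by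
  refine ⟨4 ^ z.re * Real.exp (Real.pi * |z.im|), by positivity, fun s hs => ?_⟩
  have hpos : 0 < 1 + ‖s‖ := by positivity
  calc ‖expMean s ^ z‖ ≤ ‖expMean s‖ ^ z.re / Real.exp ((expMean s).arg * z.im) :=
        Complex.norm_cpow_le _ _
    _ = ‖expMean s‖ ^ z.re * Real.exp (-((expMean s).arg * z.im)) := by
        rw [Real.exp_neg, div_eq_mul_inv]
    _ ≤ (4 / (1 + ‖s‖)) ^ z.re * Real.exp (Real.pi * |z.im|) := by
        gcongr
        · exact norm_expMean_le hs
        · refine (neg_le_abs _).trans ?_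
          rw [abs_mul]
          gcongr
          exact Complex.abs_arg_le_pi _
    _ = 4 ^ z.re * Real.exp (Real.pi * |z.im|) * (1 + ‖s‖) ^ (-z.re) := by
        rw [Real.div_rpow (by norm_num) hpos.le, Real.rpow_neg hpos.le]
        ring

theorem continuous_expMean_cpow_line {z : ℂ} (hz : 0 < z.re) {σ : ℝ} (hσ : 0 ≤ σ) :
    Continuous fun ω : ℝ => expMean (σ + ω * Complex.I) ^ z := by
  rw [continuous_iff_continuousAt]
  intro ω
  exact ContinuousAt.comp (f := fun ω : ℝ => (σ + ω * Complex.I : ℂ))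
    (g := fun s => expMean s ^ z) (continuousAt_expMean_cpow hz (by simpa using hσ))
    (by fun_prop)

theorem integrable_expMean_cpow_line {z : ℂ} (hz : 1 < z.re) {σ : ℝ} (hσ : 0 ≤ σ) :
    Integrable fun ω : ℝ => expMean (σ + ω * Complex.I) ^ z := by
  have hz0 : 0 < z.re := by linarith
  obtain ⟨C, hC, hb⟩ := norm_expMean_cpow_le hz0
  have hi : Integrable fun ω : ℝ => C * (1 + ‖ω‖) ^ (-z.re) :=
    (integrable_one_add_norm (by simpa using hz)).const_mul C
  refine hi.mono' (continuous_expMean_cpow_line hz0 hσ).aestronglyMeasurable ?_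
  refine Eventually.of_forall fun ω => (hb _ (by simpa using hσ)).trans ?_
  have h : ‖ω‖ ≤ ‖(σ + ω * Complex.I : ℂ)‖ := by
    simpa using Complex.abs_im_le_norm (σ + ω * Complex.I : ℂ)
  refine mul_le_mul_of_nonneg_left ?_ hC
  exact Real.rpow_le_rpow_of_nonpos (by positivity) (by linarith) (by linarith)

/-- Causality. For `x ≤ 0` the integrand `e^{sx} ((1 - e^{-s}) / s)^z` is holomorphic and
`O(|s|^{-Re z})` on the right half-plane, so by Cauchy's theorem its integral over the segment
`[σ - iR, σ + iR]` equals that over the other three sides of a rectangle of width `R`, which is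
`O(R^{1 - Re z})`. -/
theorem integral_exp_mul_expMean_cpow_eq_zero {z : ℂ} (hz : 1 < z.re) {σ : ℝ} (hσ : 0 ≤ σ)
    {x : ℝ} (hx : x ≤ 0) :
    ∫ ω : ℝ, Complex.exp ((σ + ω * Complex.I) * x) * expMean (σ + ω * Complex.I) ^ z = 0 := by
  have hz0 : 0 < z.re := by linarith
  set H : ℂ → ℂ := fun s => Complex.exp (s * x) * expMean s ^ z with hH
  obtain ⟨C, hC, hb⟩ := norm_expMean_cpow_le hz0
  have hexp : ∀ s : ℂ, 0 ≤ s.re → ‖Complex.exp (s * x)‖ ≤ 1 := fun s hs => by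
    rw [Complex.norm_exp, Real.exp_le_one_iff]
    simpa using mul_nonpos_of_nonneg_of_nonpos hs hx
  have hHb : ∀ R : ℝ, 0 < R → ∀ s : ℂ, 0 ≤ s.re → R ≤ ‖s‖ → ‖H s‖ ≤ C * R ^ (-z.re) := by
    intro R hR s hs hRs
    rw [hH, norm_mul]
    refine (mul_le_of_le_one_left (norm_nonneg _) (hexp s hs)).trans ((hb s hs).trans ?_)
    refine mul_le_mul_of_nonneg_left ?_ hC
    exact Real.rpow_le_rpow_of_nonpos hR (by linarith) (by linarith)
  have hint : Integrable fun ω : ℝ => H (σ + ω * Complex.I) := by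
    refine (integrable_expMean_cpow_line hz hσ).bdd_mul (c := 1) ?_ ?_
    · exact (by fun_prop : Continuous fun ω : ℝ =>
        Complex.exp ((σ + ω * Complex.I) * x)).aestronglyMeasurable
    · exact Eventually.of_forall fun ω => hexp _ (by simpa using hσ)
  have hbound : ∀ R : ℝ, 0 < R →
      ‖∫ ω in (-R)..R, H (σ + ω * Complex.I)‖ ≤ 4 * C * R ^ (-(z.re - 1)) := by
    intro R hR
    have hrect := Complex.integral_boundary_rect_eq_zero_of_continuousOn_of_differentiableOn H
      (⟨σ, -R⟩ : ℂ) (⟨σ + R, R⟩ : ℂ) ?_ ?_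
    · simp only at hrect
      have e1 : ‖∫ y in σ..(σ + R), H (y + ((-R : ℝ) : ℂ) * Complex.I)‖
          ≤ C * R ^ (-z.re) * |σ + R - σ| := by
        refine intervalIntegral.norm_integral_le_of_norm_le_const fun y hy => ?_
        rw [uIoc_of_le (by linarith)] at hy
        refine hHb R hR _ (by simpa using hσ.trans hy.1.le) ?_
        have := Complex.abs_im_le_norm (y + ((-R : ℝ) : ℂ) * Complex.I)
        simp [abs_of_pos hR] at this
        simpa using this
      have e2 : ‖∫ y in σ..(σ + R), H (y + (R : ℂ) * Complex.I)‖
          ≤ C * R ^ (-z.re) * |σ + R - σ| := by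
        refine intervalIntegral.norm_integral_le_of_norm_le_const fun y hy => ?_
        rw [uIoc_of_le (by linarith)] at hy
        refine hHb R hR _ (by simpa using hσ.trans hy.1.le) ?_
        have := Complex.abs_im_le_norm (y + (R : ℂ) * Complex.I)
        simpa [abs_of_pos hR] using this
      have e3 : ‖∫ y in (-R)..R, H (((σ + R : ℝ) : ℂ) + y * Complex.I)‖
          ≤ C * R ^ (-z.re) * |R - (-R)| := by
        refine intervalIntegral.norm_integral_le_of_norm_le_const fun y _ => ?_
        have hσR : 0 ≤ σ + R := by linarith
        refine hHb R hR _ (by simpa using hσR) ?_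
        have := Complex.abs_re_le_norm (((σ + R : ℝ) : ℂ) + y * Complex.I)
        simp only [Complex.add_re, Complex.ofReal_re, Complex.mul_re, Complex.I_re, mul_zero,
          Complex.ofReal_im, Complex.I_im, zero_mul, sub_zero, add_zero, abs_of_nonneg hσR] at this
        linarith
      have key := congrArg norm (sub_eq_zero.1 hrect).symm
      rw [norm_smul, Complex.norm_I, one_mul] at key
      rw [key]
      have hpow : R ^ (-(z.re - 1)) = R ^ (-z.re) * R := by
        rw [show -(z.re - 1) = -z.re + 1 by ring, Real.rpow_add_one hR.ne']
      rw [show σ + R - σ = R by ring, abs_of_pos hR] at e1 e2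
      rw [show R - -R = 2 * R by ring, abs_of_pos (by linarith : (0 : ℝ) < 2 * R)] at e3
      rw [hpow]
      refine (norm_add_le _ _).trans ?_
      rw [norm_smul, Complex.norm_I, one_mul]
      refine (add_le_add_left (norm_sub_le _ _) _).trans ?_
      linarith
    · intro s hs
      have h1 := hs.1
      simp only [mem_preimage, uIcc_of_le (by linarith : σ ≤ σ + R)] at h1
      refine ContinuousAt.continuousWithinAt (ContinuousAt.mul (by fun_prop) ?_)
      exact continuousAt_expMean_cpow hz0 (hσ.trans h1.1)
    · intro s hs
      have h1 := hs.1
      simp only [mem_preimage, min_eq_left (by linarith : σ ≤ σ + R)] at h1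
      refine DifferentiableAt.differentiableWithinAt (DifferentiableAt.mul (by fun_prop) ?_)
      exact differentiableAt_expMean_cpow z (hσ.trans_lt h1.1)
  have hlim := intervalIntegral_tendsto_integral hint tendsto_neg_atTop_atBot tendsto_id
  refine tendsto_nhds_unique hlim
    (squeeze_zero_norm' (a := fun R => 4 * C * R ^ (-(z.re - 1))) ?_ ?_)
  · filter_upwards [eventually_gt_atTop 0] with R hR using hbound R hR
  · simpa using (tendsto_rpow_neg_atTop (by linarith : 0 < z.re - 1)).const_mul (4 * C)

/-! ### The seeds belong to `C_{0,0}` and do not vanish -/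

open FourierTransform in
theorem inverseFourier_eq_fourierInv (φ : ℝ → ℂ) (x : ℝ) :
    inverseFourier φ x = (2 * Real.pi : ℂ)⁻¹ * 𝓕⁻ φ (x / (2 * Real.pi)) := by
  rw [inverseFourier, Real.fourierInv_eq']
  congr 2
  funext ω
  rw [smul_eq_mul]
  congr 2
  have : (Real.pi : ℂ) ≠ 0 := by exact_mod_cast Real.pi_ne_zero
  simp
  field_simp

open FourierTransform in
theorem continuous_inverseFourier {φ : ℝ → ℂ} (hφ : Integrable φ) :
    Continuous (inverseFourier φ) := by
  have h : Continuous (𝓕⁻ φ) := by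
    rw [show 𝓕⁻ φ = fun x => 𝓕 φ (-x) from funext (Real.fourierInv_eq_fourier_neg φ)]
    exact (VectorFourier.fourierIntegral_continuous Real.continuous_fourierChar
      (by exact continuous_inner) hφ).comp continuous_neg
  rw [funext (inverseFourier_eq_fourierInv φ)]
  fun_prop

/-- Riemann-Lebesgue lemma. -/
theorem tendsto_inverseFourier_atTop (φ : ℝ → ℂ) :
    Tendsto (inverseFourier φ) atTop (𝓝 0) := by
  have h : Tendsto (fun x : ℝ => -(x / (2 * Real.pi))) atTop (cocompact ℝ) :=
    (tendsto_neg_atTop_atBot.comp (tendsto_id.atTop_div_const (by positivity))).mono_right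
      atBot_le_cocompact
  rw [funext (inverseFourier_eq_fourierInv φ)]
  simp only [Real.fourierInv_eq_fourier_neg]
  simpa using ((Real.zero_at_infty_fourier φ).comp h).const_mul (2 * Real.pi : ℂ)⁻¹

open FourierTransform in
/-- Fourier inversion: a continuous integrable function with vanishing inverse Fourier integral
is zero. -/
theorem eq_zero_of_inverseFourier_eq_zero {φ : ℝ → ℂ} (hc : Continuous φ) (hφ : Integrable φ)
    (h : ∀ x, inverseFourier φ x = 0) : φ = 0 := by
  have hπ : (2 * Real.pi : ℂ) ≠ 0 := by simp [Real.pi_ne_zero]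
  have h1 : 𝓕⁻ φ = 0 := by
    funext y
    have := h (2 * Real.pi * y)
    rw [inverseFourier_eq_fourierInv, mul_div_cancel_left₀ _ (by positivity)] at this
    exact (mul_eq_zero.1 this).resolve_left (inv_ne_zero hπ)
  have h2 : 𝓕 φ = 0 := by
    funext y
    rw [← neg_neg y, ← Real.fourierInv_eq_fourier_neg, h1]
    rfl
  rw [← hc.fourierInv_fourier_eq hφ (by rw [h2]; exact integrable_zero _ _ _), h2]
  funext y
  simp [Real.fourierInv_eq']

/-- Both seeds at once: `σ = 0` is the polynomial and `σ = a` the exponential B-spline. Vanishing on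
`(-∞, 0]` gives the value at the origin, and it leaves `[0, ∞)` as the only place where the function
can be nonzero. -/
theorem restrictNonneg_inverseFourier_mem_C00_and_ne_zero {z : ℂ} (hz : 1 < z.re)
    {σ : ℝ} (hσ : 0 ≤ σ) {φ : ℝ → ℂ} (hφ : ∀ ω, φ ω = expMean (σ + ω * Complex.I) ^ z) :
    restrictNonneg (inverseFourier φ) ∈ C00 ∧ restrictNonneg (inverseFourier φ) ≠ 0 := by
  obtain rfl : φ = fun ω : ℝ => expMean (σ + ω * Complex.I) ^ z := funext hφ
  set φ : ℝ → ℂ := fun ω => expMean (σ + ω * Complex.I) ^ z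
  have hint : Integrable φ := integrable_expMean_cpow_line hz hσ
  have hcont : Continuous φ := continuous_expMean_cpow_line (by linarith) hσ
  have hneg : ∀ x ≤ 0, inverseFourier φ x = 0 := by
    intro x hx
    have h := integral_exp_mul_expMean_cpow_eq_zero hz hσ hx
    have h1 : ∀ ω : ℝ, Complex.exp ((σ + ω * Complex.I) * x) * φ ω =
        Complex.exp (σ * x) * (Complex.exp (Complex.I * ω * x) * φ ω) := fun ω => by
      rw [← mul_assoc, ← Complex.exp_add]
      ring_nf
    change ∫ ω : ℝ, Complex.exp ((σ + ω * Complex.I) * x) * φ ω = 0 at h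
    simp only [h1] at h
    rw [integral_const_mul] at h
    rw [inverseFourier, (mul_eq_zero.1 h).resolve_left (Complex.exp_ne_zero _), mul_zero]
  refine ⟨⟨?_, hneg 0 le_rfl, ?_⟩, fun h0 => ?_⟩
  · exact (continuous_inverseFourier hint).comp NNReal.continuous_coe
  · exact (tendsto_inverseFourier_atTop φ).comp (NNReal.tendsto_coe_atTop.2 tendsto_id)
  · have hzero : φ = 0 := eq_zero_of_inverseFourier_eq_zero hcont hint fun x => by
      rcases le_total x 0 with hx | hx
      · exact hneg x hx
      · exact congrFun h0 ⟨x, hx⟩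
    have hne : expMean (σ + (0 : ℝ) * Complex.I) ^ z ≠ 0 := by
      rw [Complex.cpow_ne_zero_iff_of_exponent_ne_zero (fun h => by simp [h] at hz; linarith)]
      rcases hσ.eq_or_lt with h | h
      · simp [← h, expMean_zero]
      · exact Complex.slitPlane_ne_zero (expMean_mem_slitPlane (by simpa using h))
    exact hne (congrFun hzero 0)

theorem polyBSpline_mem_C00_and_ne_zero {z : ℂ} (hz : 1 < z.re) :
    restrictNonneg (polyBSpline z) ∈ C00 ∧ restrictNonneg (polyBSpline z) ≠ 0 :=
  restrictNonneg_inverseFourier_mem_C00_and_ne_zero hz le_rfl fun ω => by simp [Omega_eq_expMean]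

theorem expBSpline_mem_C00_and_ne_zero {z : ℂ} (hz : 1 < z.re) {a : ℝ} (ha : 0 < a) :
    restrictNonneg (expBSpline z a) ∈ C00 ∧ restrictNonneg (expBSpline z a) ≠ 0 :=
  restrictNonneg_inverseFourier_mem_C00_and_ne_zero hz ha.le fun ω => by rw [OmegaExp_eq_expMean ha]

/-! ### The maps `L₁` and `L₂` -/

theorem coe_L₁ (x : ℝ≥0) : (L₁ x : ℝ) = 2 / Real.pi * Real.arctan x := rfl

/-- The inverse `x ↦ tan (πx/2)` of `L₁` on `[0, 1)`. -/
noncomputable def tanHalfPi (x : ℝ≥0) : ℝ≥0 := Real.toNNReal (Real.tan (Real.pi * (x : ℝ) / 2))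

theorem pi_mul_div_two_mem {x : ℝ≥0} (hx : x < 1) :
    Real.pi * (x : ℝ) / 2 ∈ Ico 0 (Real.pi / 2) := by
  have hx' : (x : ℝ) < 1 := by exact_mod_cast hx
  have hπ := Real.pi_pos
  exact ⟨by positivity, by nlinarith⟩

theorem coe_tanHalfPi {x : ℝ≥0} (hx : x < 1) :
    (tanHalfPi x : ℝ) = Real.tan (Real.pi * (x : ℝ) / 2) :=
  Real.coe_toNNReal _ <| Real.tan_nonneg_of_nonneg_of_le_pi_div_two (pi_mul_div_two_mem hx).1
    (pi_mul_div_two_mem hx).2.le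

theorem L₁_tanHalfPi {x : ℝ≥0} (hx : x < 1) : L₁ (tanHalfPi x) = x := by
  have h := pi_mul_div_two_mem hx
  have hπ := Real.pi_pos
  apply NNReal.coe_injective
  rw [coe_L₁, coe_tanHalfPi hx, Real.arctan_tan (by linarith [h.1]) h.2]
  field_simp

theorem L₁_lt_one (x : ℝ≥0) : L₁ x < 1 := by
  rw [← NNReal.coe_lt_coe, coe_L₁, NNReal.coe_one, div_mul_eq_mul_div, div_lt_one Real.pi_pos]
  linarith [Real.arctan_lt_pi_div_two (x : ℝ)]

theorem injective_L₁ : Function.Injective L₁ := by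
  intro x y h
  have h1 := congrArg NNReal.toReal h
  rw [coe_L₁, coe_L₁] at h1
  have h2 : (2 / Real.pi : ℝ) ≠ 0 := by positivity
  exact NNReal.coe_injective (Real.arctan_injective (mul_left_cancel₀ h2 h1))

theorem range_L₁ : range L₁ = Iio 1 := by
  ext x
  constructor
  · rintro ⟨y, rfl⟩
    exact L₁_lt_one y
  · exact fun hx => ⟨_, L₁_tanHalfPi hx⟩

theorem injective_L₂ : Function.Injective L₂ := add_left_injective 1

theorem range_L₂ : range L₂ = Ici 1 := by
  ext x
  constructor
  · rintro ⟨y, rfl⟩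
    exact le_add_self (a := (1 : ℝ≥0)) (b := y)
  · exact fun hx => ⟨x - 1, tsub_add_cancel_of_le hx⟩

theorem invFun_L₁ {x : ℝ≥0} (hx : x < 1) : Function.invFun L₁ x = tanHalfPi x := by
  conv_lhs => rw [← L₁_tanHalfPi hx]
  exact Function.leftInverse_invFun injective_L₁ _

theorem invFun_L₂ {x : ℝ≥0} (hx : 1 ≤ x) : Function.invFun L₂ x = x - 1 := by
  conv_lhs => rw [← show L₂ (x - 1) = x from tsub_add_cancel_of_le hx]
  exact Function.leftInverse_invFun injective_L₂ _

theorem continuousOn_tanHalfPi : ContinuousOn tanHalfPi (Iio 1) := by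
  intro x hx
  refine ContinuousAt.continuousWithinAt ?_
  have h := pi_mul_div_two_mem hx
  have hcos : Real.cos (Real.pi * (x : ℝ) / 2) ≠ 0 :=
    (Real.cos_pos_of_mem_Ioo ⟨by linarith [h.1, Real.pi_pos], h.2⟩).ne'
  refine continuous_real_toNNReal.continuousAt.comp ?_
  exact ContinuousAt.comp (f := fun x : ℝ≥0 => Real.pi * (x : ℝ) / 2) (g := Real.tan)
    (Real.continuousAt_tan.2 hcos) (by fun_prop)

theorem tendsto_tanHalfPi : Tendsto tanHalfPi (𝓝[<] 1) atTop := by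
  refine tendsto_real_toNNReal_atTop.comp (Real.tendsto_tan_pi_div_two.comp ?_)
  refine tendsto_nhdsWithin_iff.2 ⟨?_, ?_⟩
  · have : Continuous fun x : ℝ≥0 => Real.pi * (x : ℝ) / 2 := by fun_prop
    simpa using (this.tendsto 1).mono_left nhdsWithin_le_nhds
  · filter_upwards [self_mem_nhdsWithin] with x hx using (pi_mul_div_two_mem hx).2

/-! ### The Read-Bajraktarević operator on `C_{0,0}` -/

theorem rbOperator_of_lt_one (α : Fin 2 → ℝ) (f g : ℝ≥0 → ℂ) {x : ℝ≥0} (hx : x < 1) :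
    rbOperator ![L₁, L₂] α f g x = f x + (α 0 : ℂ) * g (tanHalfPi x) := by
  simp [rbOperator, Fin.sum_univ_two, range_L₁, range_L₂, hx, invFun_L₁ hx]

theorem rbOperator_of_one_le (α : Fin 2 → ℝ) (f g : ℝ≥0 → ℂ) {x : ℝ≥0} (hx : 1 ≤ x) :
    rbOperator ![L₁, L₂] α f g x = f x + (α 1 : ℂ) * g (x - 1) := by
  simp [rbOperator, Fin.sum_univ_two, range_L₁, range_L₂, hx, invFun_L₂ hx]

theorem tanHalfPi_zero : tanHalfPi 0 = 0 := by simp [tanHalfPi]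

/-- Extending `g ∘ L₁⁻¹` from `[0, 1)` by zero is continuous because `g` vanishes at infinity. -/
theorem continuous_indicator_comp_tanHalfPi {g : ℝ≥0 → ℂ} (hg : g ∈ C00) :
    Continuous ((Iio 1).indicator fun x => g (tanHalfPi x)) := by
  rw [continuous_iff_continuousAt]
  intro x
  rcases lt_trichotomy x 1 with hx | rfl | hx
  · refine ContinuousAt.congr (f := fun x => g (tanHalfPi x)) ?_ ?_
    · exact hg.1.continuousAt.comp (continuousOn_tanHalfPi.continuousAt (Iio_mem_nhds hx))
    · filter_upwards [Iio_mem_nhds hx] with y hy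
      exact (indicator_of_mem (s := Iio 1) hy fun x => g (tanHalfPi x)).symm
  · have hval : (Iio (1 : ℝ≥0)).indicator (fun x => g (tanHalfPi x)) 1 = 0 :=
      indicator_of_notMem (by simp) _
    refine continuousAt_iff_continuous_left'_right'.2 ⟨?_, ?_⟩
    · rw [ContinuousWithinAt, hval]
      refine (hg.2.2.comp tendsto_tanHalfPi).congr' ?_
      filter_upwards [self_mem_nhdsWithin] with y hy using (indicator_of_mem hy _).symm
    · rw [ContinuousWithinAt, hval]
      refine tendsto_const_nhds.congr' ?_
      filter_upwards [self_mem_nhdsWithin] with y hy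
      exact (indicator_of_notMem (show y ∉ Iio 1 from not_lt.2 (mem_Ioi.1 hy).le) _).symm
  · refine ContinuousAt.congr (f := fun _ => (0 : ℂ)) continuousAt_const ?_
    filter_upwards [Ioi_mem_nhds hx] with y hy
    exact (indicator_of_notMem (show y ∉ Iio 1 from not_lt.2 (mem_Ioi.1 hy).le) _).symm

theorem rbOperator_mem_C00 (α : Fin 2 → ℝ) {f g : ℝ≥0 → ℂ} (hf : f ∈ C00) (hg : g ∈ C00) :
    rbOperator ![L₁, L₂] α f g ∈ C00 := by
  -- Truncated subtraction and `g 0 = 0` make `x ↦ g (x - 1)` the extension of `g ∘ L₂⁻¹` by zero.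
  have heq : rbOperator ![L₁, L₂] α f g = fun x => f x +
      (α 0 : ℂ) * (Iio 1).indicator (fun x => g (tanHalfPi x)) x + (α 1 : ℂ) * g (x - 1) := by
    funext x
    rcases lt_or_ge x 1 with hx | hx
    · rw [rbOperator_of_lt_one _ _ _ hx, indicator_of_mem (show x ∈ Iio 1 from hx),
        tsub_eq_zero_of_le hx.le, hg.2.1]
      ring
    · rw [rbOperator_of_one_le _ _ _ hx, indicator_of_notMem (show x ∉ Iio 1 from not_lt.2 hx)]
      ring
  refine ⟨?_, ?_, ?_⟩
  · have h1 := continuous_indicator_comp_tanHalfPi hg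
    have h2 : Continuous fun x : ℝ≥0 => g (x - 1) := hg.1.comp (continuous_id.sub continuous_const)
    have h3 := hf.1
    rw [heq]
    exact (h3.add (h1.const_mul _)).add (h2.const_mul _)
  · rw [rbOperator_of_lt_one _ _ _ zero_lt_one, tanHalfPi_zero, hf.2.1, hg.2.1]
    simp
  · have h1 : Tendsto (fun x : ℝ≥0 => x - 1) atTop atTop :=
      tendsto_atTop.2 fun b => by
        filter_upwards [eventually_ge_atTop (b + 1)] with x hx using le_tsub_of_add_le_right hx
    have h2 : Tendsto (fun x => f x + (α 1 : ℂ) * g (x - 1)) atTop (𝓝 0) := by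
      simpa using hf.2.2.add ((hg.2.2.comp h1).const_mul (α 1 : ℂ))
    refine h2.congr' ?_
    filter_upwards [eventually_ge_atTop 1] with x hx using (rbOperator_of_one_le _ _ _ hx).symm

theorem norm_rbOperator_sub_le {α : Fin 2 → ℝ} {K : ℝ} (hK : ∀ n, |α n| ≤ K) (f : ℝ≥0 → ℂ)
    {g h : ℝ≥0 → ℂ} {M : ℝ} (hM : ∀ x, ‖g x - h x‖ ≤ M) (x : ℝ≥0) :
    ‖rbOperator ![L₁, L₂] α f g x - rbOperator ![L₁, L₂] α f h x‖ ≤ K * M := by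
  have hK0 : 0 ≤ K := (abs_nonneg _).trans (hK 0)
  rcases lt_or_ge x 1 with hx | hx
  · rw [rbOperator_of_lt_one _ _ _ hx, rbOperator_of_lt_one _ _ _ hx, add_sub_add_left_eq_sub,
      ← mul_sub, norm_mul, Complex.norm_real]
    exact mul_le_mul (hK 0) (hM _) (norm_nonneg _) hK0
  · rw [rbOperator_of_one_le _ _ _ hx, rbOperator_of_one_le _ _ _ hx, add_sub_add_left_eq_sub,
      ← mul_sub, norm_mul, Complex.norm_real]
    exact mul_le_mul (hK 1) (hM _) (norm_nonneg _) hK0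

/-! ### The fixed point and its dependence on the parameters -/

open scoped ZeroAtInfty

/-- `C_{0,0}` as a subset of the Banach space `C₀([0, ∞), ℂ)` with the sup norm. -/
def C00Sub : Set C₀(ℝ≥0, ℂ) := {g | g 0 = 0}

theorem continuous_eval_zero : Continuous fun g : C₀(ℝ≥0, ℂ) => g 0 := by
  have h : Continuous fun g : C₀(ℝ≥0, ℂ) => g.toBCF 0 :=
    (continuous_eval_const (F := BoundedContinuousFunction ℝ≥0 ℂ) 0).comp
      ZeroAtInftyContinuousMap.isometry_toBCF.continuous
  exact h

theorem isClosed_C00Sub : IsClosed C00Sub := isClosed_eq continuous_eval_zero continuous_const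

theorem coe_mem_C00 {g : C₀(ℝ≥0, ℂ)} (hg : g ∈ C00Sub) : ⇑g ∈ C00 :=
  ⟨g.continuous, hg, cocompact_eq_atTop (α := ℝ≥0) ▸ g.zero_at_infty'⟩

/-- An element of `C_{0,0}`, bundled as a point of the complete metric space `C00Sub`. -/
def toC00Sub (g : ℝ≥0 → ℂ) (hg : g ∈ C00) : C00Sub :=
  ⟨⟨⟨g, hg.1⟩, (cocompact_eq_atTop (α := ℝ≥0)).symm ▸ hg.2.2⟩, hg.2.1⟩

/-- The Read-Bajraktarević operator as a self-map of `C00Sub`. -/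
noncomputable def rbMap (α : Fin 2 → ℝ) {f : ℝ≥0 → ℂ} (hf : f ∈ C00) (g : C00Sub) : C00Sub :=
  toC00Sub (rbOperator ![L₁, L₂] α f g.1) (rbOperator_mem_C00 α hf (coe_mem_C00 g.2))

theorem exists_contractingWith_rbMap {α : Fin 2 → ℝ} (hα : α ∈ params) {f : ℝ≥0 → ℂ}
    (hf : f ∈ C00) : ∃ K : ℝ≥0, ContractingWith K (rbMap α hf) := by
  have hmax : max |α 0| |α 1| < 1 := max_lt (hα 0) (hα 1)
  have hK : ∀ n, |α n| ≤ max |α 0| |α 1| := by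
    intro n
    fin_cases n
    · exact le_max_left _ _
    · exact le_max_right _ _
  refine ⟨⟨max |α 0| |α 1|, le_max_of_le_left (abs_nonneg _)⟩, hmax,
    LipschitzWith.of_dist_le_mul fun g h => ?_⟩
  rw [Subtype.dist_eq, ← ZeroAtInftyContinuousMap.dist_toBCF_eq_dist]
  refine (BoundedContinuousFunction.dist_le (mul_nonneg (NNReal.coe_nonneg _) dist_nonneg)).2
    fun x => ?_
  rw [dist_eq_norm]
  refine norm_rbOperator_sub_le hK f (fun y => ?_) x
  rw [Subtype.dist_eq, ← ZeroAtInftyContinuousMap.dist_toBCF_eq_dist, ← dist_eq_norm]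
  exact BoundedContinuousFunction.dist_coe_le_dist (f := g.1.toBCF) (g := h.1.toBCF) y

/-- Banach's fixed point theorem for the Read-Bajraktarević operator on `C_{0,0}`. -/
theorem existsUnique_fixedPoint {α : Fin 2 → ℝ} (hα : α ∈ params) {f : ℝ≥0 → ℂ} (hf : f ∈ C00) :
    ∃ g ∈ C00, rbOperator ![L₁, L₂] α f g = g ∧
      ∀ h ∈ C00, rbOperator ![L₁, L₂] α f h = h → h = g := by
  obtain ⟨K, hK⟩ := exists_contractingWith_rbMap hα hf
  have : CompleteSpace C00Sub := isClosed_C00Sub.completeSpace_coe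
  have : Nonempty C00Sub := ⟨toC00Sub f hf⟩
  set p := ContractingWith.fixedPoint (rbMap α hf) hK
  have hp : rbMap α hf p = p := hK.fixedPoint_isFixedPt
  have hcoe : ∀ {q r : C00Sub}, q = r → (⇑q.1 : ℝ≥0 → ℂ) = r.1 := fun h => by rw [h]
  refine ⟨p.1, coe_mem_C00 p.2, hcoe hp, fun h hh hfix => ?_⟩
  have h1 : Function.IsFixedPt (rbMap α hf) (toC00Sub h hh) := by
    apply Subtype.ext
    apply DFunLike.coe_injective
    exact hfix
  exact hcoe (hK.fixedPoint_unique h1)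

theorem selfReferential_of_fixed {α : Fin 2 → ℝ} {f g : ℝ≥0 → ℂ}
    (h : rbOperator ![L₁, L₂] α f g = g) : SelfReferential α f g := by
  refine ⟨fun x hx => ?_, fun x hx => ?_⟩
  · conv_lhs => rw [← h]
    exact rbOperator_of_lt_one _ _ _ hx
  · conv_lhs => rw [← h]
    exact rbOperator_of_one_le _ _ _ hx

/-- A function is a fixed point for at most one parameter if the seed is nonzero: otherwise
`(α n - β n) • g ∘ (L n)⁻¹ = 0` with `α n ≠ β n` for some `n`, so that `g = 0`, and the seed is
zero too. -/
theorem eq_of_fixed_of_fixed {α β : Fin 2 → ℝ} {f g : ℝ≥0 → ℂ} (hf : f ≠ 0)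
    (hα : rbOperator ![L₁, L₂] α f g = g) (hβ : rbOperator ![L₁, L₂] β f g = g) : α = β := by
  have hg : ∃ y, g y ≠ 0 := by
    by_contra! h
    obtain rfl : g = 0 := funext h
    refine hf (Eq.trans ?_ hα)
    funext x
    simp [rbOperator]
  obtain ⟨y, hy⟩ := hg
  have h := hα.trans hβ.symm
  funext n
  fin_cases n
  · have h1 := congrFun h (L₁ y)
    rw [rbOperator_of_lt_one _ _ _ (L₁_lt_one y), rbOperator_of_lt_one _ _ _ (L₁_lt_one y),
      injective_L₁ (L₁_tanHalfPi (L₁_lt_one y))] at h1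
    exact_mod_cast mul_right_cancel₀ hy (add_left_cancel h1)
  · have h1 := congrFun h (y + 1)
    rw [rbOperator_of_one_le _ _ _ le_add_self, rbOperator_of_one_le _ _ _ le_add_self,
      add_tsub_cancel_right] at h1
    exact_mod_cast mul_right_cancel₀ hy (add_left_cancel h1)

theorem not_countable_params : ¬ params.Countable := by
  intro h
  have hsub : Ioo (-1 : ℝ) 1 ⊆ (fun α : Fin 2 → ℝ => α 0) '' params := fun t ht =>
    ⟨fun _ => t, fun _ => abs_lt.2 ht, rfl⟩
  have h1 := ((h.image _).mono hsub).le_aleph0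
  rw [Cardinal.mk_Ioo_real (by norm_num)] at h1
  exact Cardinal.aleph0_lt_continuum.not_ge h1

theorem exists_fixedPoint_family {f : ℝ≥0 → ℂ} (hf : f ∈ C00) (hf0 : f ≠ 0) :
    ∃ 𝔉 : (Fin 2 → ℝ) → ℝ≥0 → ℂ,
      (∀ α ∈ params,
        MapsTo (rbOperator ![L₁, L₂] α f) C00 C00 ∧
        𝔉 α ∈ C00 ∧
        rbOperator ![L₁, L₂] α f (𝔉 α) = 𝔉 α ∧
        (∀ g ∈ C00, rbOperator ![L₁, L₂] α f g = g → g = 𝔉 α) ∧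
        SelfReferential α f (𝔉 α)) ∧
      𝔉 0 = f ∧
      ¬ (𝔉 '' params).Countable := by
  have hex : ∀ α : Fin 2 → ℝ, ∃ g : ℝ≥0 → ℂ, α ∈ params → g ∈ C00 ∧
      rbOperator ![L₁, L₂] α f g = g ∧
      ∀ h ∈ C00, rbOperator ![L₁, L₂] α f h = h → h = g := fun α => by
    by_cases hα : α ∈ params
    · obtain ⟨g, hg⟩ := existsUnique_fixedPoint hα hf
      exact ⟨g, fun _ => hg⟩
    · exact ⟨0, fun h => absurd h hα⟩
  choose 𝔉 h𝔉 using hex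
  refine ⟨𝔉, fun α hα => ?_, ?_, fun hc => ?_⟩
  · obtain ⟨h1, h2, h3⟩ := h𝔉 α hα
    exact ⟨fun g hg => rbOperator_mem_C00 α hf hg, h1, h2, h3, selfReferential_of_fixed h2⟩
  · refine ((h𝔉 0 fun n => by simp).2.2 f hf ?_).symm
    funext x
    simp [rbOperator]
  · refine not_countable_params (countable_of_injective_of_countable_image ?_ hc)
    intro α hα β hβ h
    have h1 := (h𝔉 α hα).2.1
    change 𝔉 α = 𝔉 β at h
    rw [h] at h1
    exact eq_of_fixed_of_fixed hf0 h1 (h𝔉 β hβ).2.1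

end FractalSpline

theorem mainTheorem2 (z : ℂ) (hz : 1 < z.re) (a : ℝ) (ha : 0 < a) :
    -- the two maps are bijections onto the pieces of the partition `[0, ∞) = [0, 1) ∪ [1, ∞)`
    (Function.Injective FractalSpline.L₁ ∧ range FractalSpline.L₁ = Iio 1 ∧
      Function.Injective FractalSpline.L₂ ∧ range FractalSpline.L₂ = Ici 1) ∧
    -- polynomial case
    (FractalSpline.restrictNonneg (FractalSpline.polyBSpline z) ∈ FractalSpline.C00 ∧
      ∃ 𝔅 : (Fin 2 → ℝ) → ℝ≥0 → ℂ,
        (∀ α ∈ FractalSpline.params,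
          MapsTo (FractalSpline.T₁ z α) FractalSpline.C00 FractalSpline.C00 ∧
          𝔅 α ∈ FractalSpline.C00 ∧
          FractalSpline.T₁ z α (𝔅 α) = 𝔅 α ∧
          (∀ g ∈ FractalSpline.C00, FractalSpline.T₁ z α g = g → g = 𝔅 α) ∧
          FractalSpline.SelfReferential α
            (FractalSpline.restrictNonneg (FractalSpline.polyBSpline z)) (𝔅 α)) ∧
        𝔅 0 = FractalSpline.restrictNonneg (FractalSpline.polyBSpline z) ∧
        ¬ (𝔅 '' FractalSpline.params).Countable) ∧
    -- exponential case
    (FractalSpline.restrictNonneg (FractalSpline.expBSpline z a) ∈ FractalSpline.C00 ∧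
      ∃ 𝔈 : (Fin 2 → ℝ) → ℝ≥0 → ℂ,
        (∀ α ∈ FractalSpline.params,
          MapsTo (FractalSpline.T₂ z a α) FractalSpline.C00 FractalSpline.C00 ∧
          𝔈 α ∈ FractalSpline.C00 ∧
          FractalSpline.T₂ z a α (𝔈 α) = 𝔈 α ∧
          (∀ g ∈ FractalSpline.C00, FractalSpline.T₂ z a α g = g → g = 𝔈 α) ∧
          FractalSpline.SelfReferential α
            (FractalSpline.restrictNonneg (FractalSpline.expBSpline z a)) (𝔈 α)) ∧
        𝔈 0 = FractalSpline.restrictNonneg (FractalSpline.expBSpline z a) ∧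
        ¬ (𝔈 '' FractalSpline.params).Countable) := by
  obtain ⟨hB, hB0⟩ := FractalSpline.polyBSpline_mem_C00_and_ne_zero hz
  obtain ⟨hE, hE0⟩ := FractalSpline.expBSpline_mem_C00_and_ne_zero hz ha
  exact ⟨⟨FractalSpline.injective_L₁, FractalSpline.range_L₁, FractalSpline.injective_L₂,
      FractalSpline.range_L₂⟩,
    ⟨hB, FractalSpline.exists_fixedPoint_family hB hB0⟩,
    ⟨hE, FractalSpline.exists_fixedPoint_family hE hE0⟩⟩
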